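/- All spaces are real. Let $0<p\le 1$. A $p$-Banach space is a real vector space with a complete $p$-norm, that is, a function $\|\cdot\|\ge 0$ which vanishes only at $0$ and satisfies $\|cx\|=|c|\,\|x\|$ and $\|x+y\|^p\le\|x\|^p+\|y\|^p$, the space being complete for the metric $\|x-y\|^p$. A subspace is complemented if it is the range of a continuous linear projection. A space has the separable complementation property (SCP) if each of its separable subspaces is contained in a separable complemented subspace. For a set $I$, $\ell_p(I)$ is the $p$-Banach space of all $x:I\to\mathbb R$ with $\|x\|_p=\big(\sum_{i\in I}|x(i)|^p\big)^{1/p}<\infty$. The density character of a space is the least cardinality of a dense subset. **Theorem 5.1.** Let $0<p\le 1$, let $X$ be a $p$-Banach space with the SCP and with density character $\aleph_1$, let $I$ be any set, and let $Q:\ell_p(I)\to X$ be a quotient map, that is, a continuous linear surjection. Then $\ker Q$ is (linearly homeomorphic to) a complemented subspace of a $p$-Banach space with the SCP. -/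

import Mathlib

universe u v

/-- `E`, a real vector space with a function `‖·‖` and a uniform structure, is a `p`-Banach space:
`‖·‖` is a `p`-norm, the uniform structure is the one that this `p`-norm defines, and it is
complete. -/
class PBanachSpace (p : ℝ) (E : Type u) [AddCommGroup E] [Module ℝ E] [Norm E] [UniformSpace E] :
    Prop where
  norm_nonneg : ∀ x : E, 0 ≤ ‖x‖
  eq_zero_of_norm_eq_zero : ∀ x : E, ‖x‖ = 0 → x = 0
  norm_smul : ∀ (c : ℝ) (x : E), ‖c • x‖ = |c| * ‖x‖
  norm_add_rpow_le : ∀ x y : E, ‖x + y‖ ^ p ≤ ‖x‖ ^ p + ‖y‖ ^ p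
  hasBasis_uniformity :
    (uniformity E).HasBasis (fun ε : ℝ => 0 < ε) (fun ε => {z : E × E | ‖z.1 - z.2‖ < ε})
  complete : CompleteSpace E

/-- The separable complementation property: every separable linear subspace is contained in a
separable subspace that is the range of a continuous linear projection. -/
def HasSCP (E : Type u) [AddCommGroup E] [Module ℝ E] [TopologicalSpace E] : Prop :=
  ∀ Y : Submodule ℝ E, TopologicalSpace.IsSeparable (Y : Set E) →
    ∃ W : Submodule ℝ E,
      Y ≤ W ∧ TopologicalSpace.IsSeparable (W : Set E) ∧ W.ClosedComplemented

/-- The density character: the least cardinality of a dense subset. -/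
noncomputable def densityCharacter (E : Type u) [TopologicalSpace E] : Cardinal.{u} :=
  sInf {c : Cardinal.{u} | ∃ s : Set E, Dense s ∧ Cardinal.mk s = c}

/-- The space `ℓ_p(I)` of functions `x : I → ℝ` with `∑ |x i| ^ p < ∞`. Its norm is Mathlib's
`‖x‖ = (∑ |x i| ^ p) ^ (1 / p)`. A type synonym is used because Mathlib only topologizes
`lp` for `1 ≤ p`. -/
def EllP (p : ℝ) (I : Type v) : Type v := lp (fun _ : I => ℝ) (ENNReal.ofReal p)

noncomputable section EllP

instance (p : ℝ) (I : Type v) : AddCommGroup (EllP p I) :=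
  inferInstanceAs (AddCommGroup (lp (fun _ : I => ℝ) (ENNReal.ofReal p)))

instance (p : ℝ) (I : Type v) : Module ℝ (EllP p I) :=
  inferInstanceAs (Module ℝ (lp (fun _ : I => ℝ) (ENNReal.ofReal p)))

instance (p : ℝ) (I : Type v) : Norm (EllP p I) :=
  inferInstanceAs (Norm (lp (fun _ : I => ℝ) (ENNReal.ofReal p)))

theorem EllP.norm_add_rpow_le {p : ℝ} (hp : 0 < p) (hp1 : p ≤ 1) {I : Type v} (x y : EllP p I) :
    ‖x + y‖ ^ p ≤ ‖x‖ ^ p + ‖y‖ ^ p := by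
  have hpos : 0 < (ENNReal.ofReal p).toReal := by rwa [ENNReal.toReal_ofReal hp.le]
  have key : ∀ f : lp (fun _ : I => ℝ) (ENNReal.ofReal p), ‖f‖ ^ p = ∑' i, |f i| ^ p := by
    intro f
    have h := lp.norm_rpow_eq_tsum hpos f
    rw [ENNReal.toReal_ofReal hp.le] at h
    exact h
  have hsum : ∀ f : lp (fun _ : I => ℝ) (ENNReal.ofReal p), Summable fun i => |f i| ^ p := by
    intro f
    have h := (lp.memℓp f).summable hpos
    rw [ENNReal.toReal_ofReal hp.le] at h
    exact h
  change ‖((x : lp (fun _ : I => ℝ) (ENNReal.ofReal p)) + y :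
    lp (fun _ : I => ℝ) (ENNReal.ofReal p))‖ ^ p ≤ _
  refine (key _).le.trans (le_trans ?_ (add_le_add (key x).ge (key y).ge))
  rw [← (hsum x).tsum_add (hsum y)]
  refine (hsum _).tsum_le_tsum (fun i => ?_) ((hsum x).add (hsum y))
  exact (Real.rpow_le_rpow (abs_nonneg _) (abs_add_le _ _) hp.le).trans
    (Real.rpow_add_le_add_rpow (abs_nonneg _) (abs_nonneg _) hp.le hp1)

/-- `ℓ_p(I)`, `0 < p ≤ 1`, carries the uniform structure of the metric `‖x - y‖ ^ p`. -/
instance (p : ℝ) [hp : Fact (0 < p)] [hp1 : Fact (p ≤ 1)] (I : Type v) :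
    UniformSpace (EllP p I) :=
  UniformSpace.ofDist (fun x y => ‖x - y‖ ^ p)
    (fun x => by
      have h : ‖(0 : EllP p I)‖ = 0 :=
        lp.norm_zero (E := fun _ : I => ℝ) (p := ENNReal.ofReal p)
      simp only [sub_self, h, Real.zero_rpow hp.out.ne'])
    (fun x y => by
      have h : ‖-(x - y)‖ = ‖x - y‖ :=
        lp.norm_neg (E := fun _ : I => ℝ) (p := ENNReal.ofReal p) (f := x - y)
      rw [← h, neg_sub])
    (fun x y z => by
      have h := EllP.norm_add_rpow_le hp.out hp1.out (x - y) (y - z)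
      rwa [sub_add_sub_cancel] at h)

end EllP

/-!
The kernel of `Q : ℓ_p(I) → X` is exhibited as a retract of the kernel of another operator into `X`,
chosen so that its kernel has the separable complementation property (SCP).

Let `B` be the unit ball of `X`, and let `A : ℓ_p(B ⊔ I) → X` send the unit vector `e_x`, `x ∈ B`,
to `x`, and `e_i`, `i ∈ I`, to `Q e_i`. Extension by zero maps `ker Q` into `ker A`. Conversely, by
the open mapping theorem the points `x ∈ B` have `Q`-preimages `l x` of bounded norm; the operator
`ℓ_p(B ⊔ I) → ℓ_p(I)` with `e_x ↦ l x` and `e_i ↦ e_i` lifts `A` through `Q`, so it maps `ker A` into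
`ker Q`, and it is a left inverse of the extension by zero. So `ker Q` is isomorphic to a
complemented subspace of `ker A`.

That `ker A` has the SCP (`HasSCP.ker`) only uses that every point of `B` is some `A e_j`. A separable
subspace of `ker A` is supported on a countable set `s₀` of indices. The SCP of `X` gives a separable
`W`, complemented by a projection `P`, with `A e_j ∈ W` for `j ∈ s₀`. Enlarge `s₀` to a countable `s`
by adding an index `j` with `A e_j = d` for each `d` in a countable dense subset of `B ∩ W`. Then `A`
maps the vectors supported on `s` onto `W`, with bounded liftings. Let `R` fix `e_j` for `j ∈ s` and
send every other `e_j` to a bounded lifting of `P A e_j` supported on `s`. Then `A R = P A`, so `R`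
restricts to a projection of `ker A` onto its separable subspace of vectors supported on `s`.

The tools are those of `p`-Banach spaces: convergence of absolutely `p`-summable series, the open
mapping theorem (`PBanachSpace.exists_preimage_norm_le`) and the universal property of `ℓ_p(I)`
(`EllP.exists_lift`).
-/

open Filter Topology TopologicalSpace

/-! ### `p`-Banach spaces -/

namespace PBanachSpace

variable (p : ℝ) (E : Type*) [AddCommGroup E] [Module ℝ E] [Norm E] [UniformSpace E]
  [PBanachSpace p E]

include p in
theorem norm_zero : ‖(0 : E)‖ = 0 := by
  simpa using norm_smul p (0 : ℝ) (0 : E)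

variable {E}

include p in
theorem norm_neg (x : E) : ‖-x‖ = ‖x‖ := by
  simpa using norm_smul p (-1 : ℝ) x

include p in
theorem norm_sub_rpow_le (x y : E) : ‖x - y‖ ^ p ≤ ‖x‖ ^ p + ‖y‖ ^ p := by
  rw [← norm_neg p y, sub_eq_add_neg]
  exact norm_add_rpow_le x (-y)

include p in
theorem nhds_hasBasis (x : E) :
    (𝓝 x).HasBasis (fun ε : ℝ => 0 < ε) (fun ε => {y : E | ‖y - x‖ < ε}) :=
  nhds_basis_uniformity (hasBasis_uniformity p)

/-- A subspace with the restricted `p`-norm is `p`-Banach if it is closed. -/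
theorem submodule {K : Submodule ℝ E} (hK : IsClosed (K : Set E)) :
    letI : Norm K := ⟨fun x => ‖(x : E)‖⟩
    PBanachSpace p K := by
  let _ : Norm K := ⟨fun x => ‖(x : E)‖⟩
  have : CompleteSpace E := complete p
  exact
  { norm_nonneg := fun x => norm_nonneg p (x : E)
    eq_zero_of_norm_eq_zero := fun x h => Subtype.ext (eq_zero_of_norm_eq_zero p (x : E) h)
    norm_smul := fun c x => norm_smul p c (x : E)
    norm_add_rpow_le := fun x y => norm_add_rpow_le (x : E) (y : E)
    hasBasis_uniformity := by
      rw [uniformity_subtype]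
      exact (hasBasis_uniformity p (E := E)).comap _
    complete := hK.completeSpace_coe }

variable {F : Type*} [AddCommGroup F] [Module ℝ F] [Norm F] [UniformSpace F] [PBanachSpace p F]

include p in
theorem exists_norm_le (A : E →L[ℝ] F) : ∃ C : ℝ, 0 < C ∧ ∀ x, ‖A x‖ ≤ C * ‖x‖ := by
  have h : Tendsto A (𝓝 0) (𝓝 0) := by simpa using A.continuous.tendsto 0
  obtain ⟨δ, hδ, h1⟩ :=
    (((nhds_hasBasis p (0 : E)).tendsto_iff (nhds_hasBasis p (0 : F))).1 h) 1 one_pos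
  simp only [Set.mem_ofPred_eq, sub_zero] at h1
  refine ⟨2 / δ, by positivity, fun x => ?_⟩
  rcases (norm_nonneg p x).eq_or_lt with hx | hx
  · rw [eq_zero_of_norm_eq_zero p x hx.symm, map_zero, norm_zero p, norm_zero p, mul_zero]
  have h2 := h1 ((δ / 2 / ‖x‖) • x) (by
    rw [norm_smul p, abs_of_pos (by positivity), div_mul_cancel₀ _ hx.ne']
    linarith)
  rw [map_smul, norm_smul p, abs_of_pos (by positivity)] at h2
  have h3 : ‖A x‖ = 2 / δ * ‖x‖ * (δ / 2 / ‖x‖ * ‖A x‖) := by field_simp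
  rw [h3]
  exact mul_le_of_le_one_right (by positivity) h2.le

variable [hp : Fact (0 < p)]

variable (E) in
/-- The group norm `‖x‖ ^ p` on a `p`-Banach space, as a `NormedAddCommGroup` structure whose
uniformity is the given one. It makes Mathlib's theory of complete normed groups available. -/
@[reducible] noncomputable def rpowNormedAddCommGroup : NormedAddCommGroup E where
  __ := ‹AddCommGroup E›
  norm x := ‖x‖ ^ p
  dist x y := ‖x - y‖ ^ p
  dist_self x := by simp [norm_zero p E, hp.out.ne']
  dist_comm x y := by rw [← norm_neg p (x - y), neg_sub]
  dist_triangle x y z := by simpa using norm_add_rpow_le (p := p) (x - y) (y - z)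
  eq_of_dist_eq_zero {x y} h :=
    sub_eq_zero.1 <| eq_zero_of_norm_eq_zero p _ <|
      (Real.rpow_eq_zero (norm_nonneg p _) hp.out.ne').1 h
  dist_eq x y := by
    rw [← norm_neg p (x - y)]
    congr 2
    abel
  toUniformSpace := ‹UniformSpace E›
  uniformity_dist := by
    refine (hasBasis_uniformity p (E := E)).ext (hasBasis_biInf_principal' ?_ ⟨1, one_pos⟩) ?_ ?_
    · intro a ha b hb
      exact ⟨min a b, lt_min ha hb, fun z (hz : _ < _) => hz.trans_le (min_le_left a b),
        fun z (hz : _ < _) => hz.trans_le (min_le_right a b)⟩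
    · intro ε hε
      exact ⟨ε ^ p, Real.rpow_pos_of_pos hε p, fun z (hz : _ < _) =>
        (Real.rpow_lt_rpow_iff (norm_nonneg p _) hε.le hp.out).1 hz⟩
    · intro ε hε
      exact ⟨ε ^ p⁻¹, Real.rpow_pos_of_pos hε _, fun z (hz : _ < _) =>
        (Real.lt_rpow_inv_iff_of_pos (norm_nonneg p _) hε.le hp.out).1 hz⟩

variable (E) in
include p hp in
theorem isUniformAddGroup : IsUniformAddGroup E := by
  let _ := rpowNormedAddCommGroup p E
  infer_instance

variable (E) in
include p hp in
theorem t2Space : T2Space E := by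
  let _ := rpowNormedAddCommGroup p E
  infer_instance

variable (E) in
include p hp in
theorem isCountablyGenerated_uniformity : (uniformity E).IsCountablyGenerated := by
  let _ := rpowNormedAddCommGroup p E
  infer_instance

variable (E) in
include p hp in
theorem baireSpace : BaireSpace E := by
  let _ := rpowNormedAddCommGroup p E
  have : CompleteSpace E := complete p
  infer_instance

theorem tendsto_iff_rpow {ι : Type*} {l : Filter ι} {f : ι → E} {a : E} :
    Tendsto f l (𝓝 a) ↔ Tendsto (fun i => ‖f i - a‖ ^ p) l (𝓝 0) := by
  let _ := rpowNormedAddCommGroup p E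
  exact tendsto_iff_dist_tendsto_zero

variable (E) in
include p hp in
theorem continuousSMul : ContinuousSMul ℝ E := by
  have := isUniformAddGroup p E
  have h0 (x : E) (c : ℝ) : ‖c • x‖ ^ p = |c| ^ p * ‖x‖ ^ p := by
    rw [norm_smul p, Real.mul_rpow (abs_nonneg c) (norm_nonneg p x)]
  refine ⟨continuous_iff_continuousAt.2 fun ⟨c, x⟩ => (tendsto_iff_rpow p).2 ?_⟩
  have hlim : Tendsto (fun z : ℝ × E => |z.1| ^ p * ‖z.2 - x‖ ^ p + |z.1 - c| ^ p * ‖x‖ ^ p)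
      (𝓝 (c, x)) (𝓝 (|c| ^ p * 0 + |c - c| ^ p * ‖x‖ ^ p)) := by
    have h1 : Tendsto (fun z : ℝ × E => z.1) (𝓝 (c, x)) (𝓝 c) := continuous_fst.tendsto (c, x)
    have h2 : Tendsto (fun z : ℝ × E => ‖z.2 - x‖ ^ p) (𝓝 (c, x)) (𝓝 0) :=
      (tendsto_iff_rpow p).1 (continuous_snd.tendsto (c, x))
    exact ((h1.abs.rpow_const (Or.inr hp.out.le)).mul h2).add
      (((h1.sub_const c).abs.rpow_const (Or.inr hp.out.le)).mul_const _)
  have hz : |c| ^ p * 0 + |c - c| ^ p * ‖x‖ ^ p = 0 := by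
    simp [Real.zero_rpow hp.out.ne']
  rw [hz] at hlim
  refine squeeze_zero (fun z => Real.rpow_nonneg (norm_nonneg p _) p) (fun z => ?_) hlim
  rw [← h0, ← h0]
  convert norm_add_rpow_le (p := p) (z.1 • (z.2 - x)) ((z.1 - c) • x) using 3
  simp only [smul_sub, sub_smul]
  abel

include hp in
/-- Absolute `p`-summability implies summability. -/
theorem summable_of_rpow {ι : Type*} {f : ι → E} (hf : Summable fun i => ‖f i‖ ^ p) :
    Summable f := by
  have : CompleteSpace E := complete p
  let _ := rpowNormedAddCommGroup p E
  exact Summable.of_norm hf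

include hp in
theorem rpow_norm_tsum_le {ι : Type*} {f : ι → E} (hf : Summable fun i => ‖f i‖ ^ p) :
    ‖∑' i, f i‖ ^ p ≤ ∑' i, ‖f i‖ ^ p := by
  let _ := rpowNormedAddCommGroup p E
  exact norm_tsum_le_tsum_norm (f := f) hf

theorem continuous_of_rpow_le (A : E →ₗ[ℝ] F) (C : ℝ) (h : ∀ x, ‖A x‖ ^ p ≤ C * ‖x‖ ^ p) :
    Continuous A := by
  have := isUniformAddGroup p E
  have := isUniformAddGroup p F
  refine continuous_of_continuousAt_zero A ?_
  rw [ContinuousAt, map_zero, tendsto_iff_rpow p]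
  have h2 : Tendsto (fun x : E => C * ‖x - 0‖ ^ p) (𝓝 0) (𝓝 (C * 0)) :=
    ((tendsto_iff_rpow p).1 tendsto_id).const_mul C
  rw [mul_zero] at h2
  refine squeeze_zero (fun z => Real.rpow_nonneg (norm_nonneg p _) p) (fun x => ?_) h2
  simpa using h x

include p hp in
/-- The successive approximation argument of the open mapping theorem: if each `y` in a subspace
`W` is the image of an `x` of comparable size up to an error in `W` of half the size of `y`, then
the errors can be removed. -/
theorem exists_preimage_of_approx (A : E →L[ℝ] F) (W : Submodule ℝ F) (C : ℝ)
    (h : ∀ y ∈ W, ∃ x, A x ∈ W ∧ ‖x‖ ≤ C * ‖y‖ ∧ ‖y - A x‖ ≤ 1 / 2 * ‖y‖) :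
    ∃ C' : ℝ, ∀ y ∈ W, ∃ x, A x = y ∧ ‖x‖ ≤ C' * ‖y‖ := by
  have := isUniformAddGroup p E
  have := isUniformAddGroup p F
  have := t2Space p F
  have hp0 := hp.out
  choose! g hgW hgC hg2 using h
  let q : ℝ := (1 / 2) ^ p
  have hq0 : 0 ≤ q := by positivity
  have hq1 : q < 1 := Real.rpow_lt_one (by norm_num) (by norm_num) hp0
  let D : ℝ := |C| ^ p * (1 - q)⁻¹
  have hD : 0 ≤ D := mul_nonneg (by positivity) (inv_nonneg.2 (by linarith))
  refine ⟨D ^ p⁻¹, fun y hy => ?_⟩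
  -- the successive errors
  let r : ℕ → F := fun n => (fun z => z - A (g z))^[n] y
  have hr_succ (n : ℕ) : r (n + 1) = r n - A (g (r n)) := Function.iterate_succ_apply' _ n y
  have hrW (n : ℕ) : r n ∈ W := by
    induction n with
    | zero => exact hy
    | succ n ih => rw [hr_succ]; exact W.sub_mem ih (hgW _ ih)
  have hr (n : ℕ) : ‖r n‖ ^ p ≤ q ^ n * ‖y‖ ^ p := by
    induction n with
    | zero => simp [r]
    | succ n ih =>
      rw [hr_succ, pow_succ']
      calc ‖r n - A (g (r n))‖ ^ p ≤ (1 / 2 * ‖r n‖) ^ p :=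
            Real.rpow_le_rpow (norm_nonneg p _) (hg2 _ (hrW n)) hp0.le
        _ = q * ‖r n‖ ^ p := Real.mul_rpow (by norm_num) (norm_nonneg p _)
        _ ≤ q * q ^ n * ‖y‖ ^ p := by rw [mul_assoc]; exact mul_le_mul_of_nonneg_left ih hq0
  have hx (n : ℕ) : ‖g (r n)‖ ^ p ≤ |C| ^ p * ‖y‖ ^ p * q ^ n := by
    calc ‖g (r n)‖ ^ p ≤ (|C| * ‖r n‖) ^ p :=
          Real.rpow_le_rpow (norm_nonneg p _) ((hgC _ (hrW n)).trans
            (mul_le_mul_of_nonneg_right (le_abs_self C) (norm_nonneg p _))) hp0.le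
      _ = |C| ^ p * ‖r n‖ ^ p := Real.mul_rpow (abs_nonneg C) (norm_nonneg p _)
      _ ≤ |C| ^ p * (q ^ n * ‖y‖ ^ p) := mul_le_mul_of_nonneg_left (hr n) (by positivity)
      _ = _ := by ring
  have hgeo := (summable_geometric_of_lt_one hq0 hq1).mul_left (|C| ^ p * ‖y‖ ^ p)
  have hsum : Summable fun n => ‖g (r n)‖ ^ p :=
    hgeo.of_nonneg_of_le (fun n => Real.rpow_nonneg (norm_nonneg p _) p) hx
  refine ⟨∑' n, g (r n), ?_, ?_⟩
  · have h1 : Tendsto (fun n => ∑ i ∈ Finset.range n, A (g (r i))) atTop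
        (𝓝 (A (∑' n, g (r n)))) :=
      ((summable_of_rpow p hsum).hasSum.mapL A).tendsto_sum_nat
    refine tendsto_nhds_unique h1 ?_
    have h2 (n : ℕ) : ∑ i ∈ Finset.range n, A (g (r i)) = y - r n := by
      induction n with
      | zero => simp [r]
      | succ n ih => rw [Finset.sum_range_succ, ih, hr_succ]; abel
    simp_rw [h2]
    have h3 : Tendsto r atTop (𝓝 0) := by
      rw [tendsto_iff_rpow p]
      refine squeeze_zero (fun n => Real.rpow_nonneg (norm_nonneg p _) p)
        (fun n => by simpa using hr n) ?_
      simpa using (tendsto_pow_atTop_nhds_zero_of_lt_one hq0 hq1).mul_const (‖y‖ ^ p)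
    simpa using h3.const_sub y
  · refine (Real.rpow_le_rpow_iff (norm_nonneg p _)
      (mul_nonneg (by positivity) (norm_nonneg p y)) hp0).1 ?_
    rw [Real.mul_rpow (by positivity) (norm_nonneg p y), Real.rpow_inv_rpow hD hp0.ne']
    calc ‖∑' n, g (r n)‖ ^ p ≤ ∑' n, ‖g (r n)‖ ^ p := rpow_norm_tsum_le p hsum
      _ ≤ ∑' n, |C| ^ p * ‖y‖ ^ p * q ^ n := hsum.tsum_le_tsum hx hgeo
      _ = D * ‖y‖ ^ p := by rw [tsum_mul_left, tsum_geometric_of_lt_one hq0 hq1]; ring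

include p hp in
/-- The open mapping theorem for `p`-Banach spaces, in the form of bounded liftings. -/
theorem exists_preimage_norm_le (A : E →L[ℝ] F) (hA : Function.Surjective A) :
    ∃ C : ℝ, ∀ y, ∃ x, A x = y ∧ ‖x‖ ≤ C * ‖y‖ := by
  have hp0 := hp.out
  have := baireSpace p F
  obtain ⟨n, y₀, hy₀⟩ : ∃ n : ℕ, (interior (closure (A '' {x | ‖x‖ ≤ n}))).Nonempty := by
    refine nonempty_interior_of_iUnion_of_closed (fun n => isClosed_closure) ?_
    refine Set.eq_univ_of_forall fun y => ?_
    obtain ⟨x, rfl⟩ := hA y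
    obtain ⟨n, hn⟩ := exists_nat_ge ‖x‖
    exact Set.mem_iUnion.2 ⟨n, subset_closure ⟨x, hn, rfl⟩⟩
  obtain ⟨δ, hδ, hball⟩ := (nhds_hasBasis p y₀).mem_iff.1 (mem_interior_iff_mem_nhds.1 hy₀)
  -- points of the closure are approximated up to `η`, where `2 * η ^ p = (δ / 4) ^ p`
  let η : ℝ := ((δ / 4) ^ p / 2) ^ p⁻¹
  have hη : 0 < η := by positivity
  have hηp : η ^ p = (δ / 4) ^ p / 2 := Real.rpow_inv_rpow (by positivity) hp0.ne'
  have happ : ∀ y ∈ closure (A '' {x | ‖x‖ ≤ n}), ∃ x : E, ‖x‖ ≤ n ∧ ‖A x - y‖ ≤ η := by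
    intro y hy
    obtain ⟨_, h1, x, hx, rfl⟩ :=
      mem_closure_iff_nhds.1 hy _ ((nhds_hasBasis p y).mem_of_mem hη)
    exact ⟨x, hx, le_of_lt h1⟩
  let M : ℝ := (2 * (n : ℝ) ^ p) ^ p⁻¹
  have hM : 0 ≤ M := by positivity
  have hMp : M ^ p = 2 * (n : ℝ) ^ p := Real.rpow_inv_rpow (by positivity) hp0.ne'
  -- differences of approximations at `y₀ + z` and `y₀` approximate `z`
  have key : ∀ z : F, ‖z‖ < δ → ∃ x : E, ‖x‖ ≤ M ∧ ‖z - A x‖ ≤ δ / 4 := by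
    intro z hz
    obtain ⟨x₁, hx₁, h₁⟩ := happ (y₀ + z) (hball (by simpa using hz))
    obtain ⟨x₂, hx₂, h₂⟩ := happ y₀ (hball (by simpa [norm_zero p] using hδ))
    refine ⟨x₁ - x₂, ?_, ?_⟩
    · refine (Real.rpow_le_rpow_iff (norm_nonneg p _) hM hp0).1 ?_
      rw [hMp]
      have e₁ := Real.rpow_le_rpow (norm_nonneg p _) hx₁ hp0.le
      have e₂ := Real.rpow_le_rpow (norm_nonneg p _) hx₂ hp0.le
      have := norm_sub_rpow_le p x₁ x₂
      linarith
    · refine (Real.rpow_le_rpow_iff (norm_nonneg p _) (by positivity) hp0).1 ?_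
      have e₁ := Real.rpow_le_rpow (norm_nonneg p _) h₁ hp0.le
      have e₂ := Real.rpow_le_rpow (norm_nonneg p _) h₂ hp0.le
      rw [hηp] at e₁ e₂
      have e : z - A (x₁ - x₂) = (A x₂ - y₀) - (A x₁ - (y₀ + z)) := by
        rw [map_sub]; abel
      rw [e]
      have := norm_sub_rpow_le p (A x₂ - y₀) (A x₁ - (y₀ + z))
      linarith
  obtain ⟨C', hC'⟩ := exists_preimage_of_approx p A ⊤ (M / (δ / 2)) (by
    intro y _
    rcases (norm_nonneg p y).eq_or_lt with hy | hy
    · refine ⟨0, trivial, ?_, ?_⟩ <;> simp [norm_zero p, ← hy]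
    obtain ⟨x, hx, hx'⟩ := key ((δ / 2 / ‖y‖) • y) (by
      rw [norm_smul p, abs_of_pos (by positivity), div_mul_cancel₀ _ hy.ne']
      linarith)
    have hc : 0 < ‖y‖ / (δ / 2) := by positivity
    refine ⟨(‖y‖ / (δ / 2)) • x, trivial, ?_, ?_⟩
    · rw [norm_smul p, abs_of_pos hc]
      calc ‖y‖ / (δ / 2) * ‖x‖ ≤ ‖y‖ / (δ / 2) * M := mul_le_mul_of_nonneg_left hx hc.le
        _ = _ := by ring
    · have e : y - A ((‖y‖ / (δ / 2)) • x) = (‖y‖ / (δ / 2)) • ((δ / 2 / ‖y‖) • y - A x) := by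
        rw [smul_sub, smul_smul, map_smul, div_mul_div_cancel₀ (by positivity),
          div_self hy.ne', one_smul]
      rw [e, norm_smul p, abs_of_pos hc]
      calc ‖y‖ / (δ / 2) * _ ≤ ‖y‖ / (δ / 2) * (δ / 4) := mul_le_mul_of_nonneg_left hx' hc.le
        _ = 1 / 2 * ‖y‖ := by field_simp; norm_num)
  exact ⟨C', fun y => hC' y trivial⟩

end PBanachSpace

/-! ### The spaces `ℓ_p(I)` -/

namespace EllP

variable {p : ℝ} {I : Type*}

/-- The `i`-th coordinate functional on `ℓ_p(I)`. -/
def coord (i : I) : EllP p I →ₗ[ℝ] ℝ where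
  toFun x := (show lp (fun _ : I => ℝ) (ENNReal.ofReal p) from x) i
  map_add' _ _ := rfl
  map_smul' _ _ := rfl

theorem ext_coord {x y : EllP p I} (h : ∀ i, coord i x = coord i y) : x = y :=
  lp.ext (funext h)

open Classical in
/-- The `i`-th unit vector of `ℓ_p(I)`. -/
noncomputable def single (p : ℝ) (i : I) : EllP p I :=
  lp.single (ENNReal.ofReal p) i (1 : ℝ)

open Classical in
theorem coord_single (i j : I) : coord j (single p i) = if j = i then 1 else 0 :=
  Pi.single_apply i (1 : ℝ) j

theorem norm_nonneg' (x : EllP p I) : 0 ≤ ‖x‖ :=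
  lp.norm_nonneg' (x : lp (fun _ : I => ℝ) (ENNReal.ofReal p))

/-- The subspace of the elements of `ℓ_p(I)` that vanish off `s`. -/
def supported (p : ℝ) (s : Set I) : Submodule ℝ (EllP p I) where
  carrier := {x | ∀ i ∉ s, coord i x = 0}
  add_mem' hx hy i hi := by rw [map_add, hx i hi, hy i hi, add_zero]
  zero_mem' _ _ := map_zero _
  smul_mem' c x hx i hi := by rw [map_smul, hx i hi, smul_zero]

theorem single_mem_supported {s : Set I} {i : I} (hi : i ∈ s) : single p i ∈ supported p s := by
  intro j hj
  rw [coord_single, if_neg]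
  rintro rfl
  exact hj hi

theorem supported_mono {s t : Set I} (h : s ⊆ t) : supported p s ≤ supported p t :=
  fun _ hx i hi => hx i fun his => hi (h his)

variable [hp : Fact (0 < p)]

theorem rpow_norm (x : EllP p I) : ‖x‖ ^ p = ∑' i, |coord i x| ^ p := by
  have hpos : 0 < (ENNReal.ofReal p).toReal := by
    rw [ENNReal.toReal_ofReal hp.out.le]; exact hp.out
  have h := lp.norm_rpow_eq_tsum hpos (x : lp (fun _ : I => ℝ) (ENNReal.ofReal p))
  rw [ENNReal.toReal_ofReal hp.out.le] at h
  exact h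

theorem summable_coord (x : EllP p I) : Summable fun i => |coord i x| ^ p := by
  have hpos : 0 < (ENNReal.ofReal p).toReal := by
    rw [ENNReal.toReal_ofReal hp.out.le]; exact hp.out
  have h := (lp.memℓp (x : lp (fun _ : I => ℝ) (ENNReal.ofReal p))).summable hpos
  rw [ENNReal.toReal_ofReal hp.out.le] at h
  exact h

theorem exists_coord_eq {f : I → ℝ} (hf : Summable fun i => |f i| ^ p) :
    ∃ x : EllP p I, ∀ i, coord i x = f i := by
  have h : Memℓp f (ENNReal.ofReal p) := memℓp_gen <| by
    rwa [ENNReal.toReal_ofReal hp.out.le]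
  exact ⟨(⟨f, h⟩ : lp (fun _ : I => ℝ) (ENNReal.ofReal p)), fun _ => rfl⟩

theorem abs_coord_rpow_le (i : I) (x : EllP p I) : |coord i x| ^ p ≤ ‖x‖ ^ p := by
  rw [rpow_norm]
  exact (summable_coord x).le_tsum i fun j _ => by positivity

theorem abs_coord_le (i : I) (x : EllP p I) : |coord i x| ≤ ‖x‖ :=
  (Real.rpow_le_rpow_iff (abs_nonneg _) (norm_nonneg' x) hp.out).1 (abs_coord_rpow_le i x)

theorem norm_single (i : I) : ‖single p i‖ = 1 := by
  have h : ‖single p i‖ ^ p = 1 := by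
    rw [rpow_norm, tsum_eq_single i]
    · simp [coord_single]
    · intro j hj
      simp [coord_single, hj, hp.out.ne']
  exact (Real.rpow_left_inj (norm_nonneg' _) zero_le_one hp.out.ne').1 (h.trans (Real.one_rpow p).symm)

variable [hp1 : Fact (p ≤ 1)]

variable (p I) in
/-- The metric `‖x - y‖ ^ p` of `ℓ_p(I)`. -/
@[reducible] noncomputable def pseudoMetricSpace : PseudoMetricSpace (EllP p I) where
  dist x y := ‖x - y‖ ^ p
  dist_self x := by
    have h : ‖(0 : EllP p I)‖ = 0 :=
      lp.norm_zero (E := fun _ : I => ℝ) (p := ENNReal.ofReal p)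
    rw [sub_self, h, Real.zero_rpow hp.out.ne']
  dist_comm x y := by
    have h : ‖-(x - y)‖ = ‖x - y‖ :=
      lp.norm_neg (E := fun _ : I => ℝ) (p := ENNReal.ofReal p) (f := x - y)
    rw [← h, neg_sub]
  dist_triangle x y z := by
    simpa using norm_add_rpow_le hp.out hp1.out (x - y) (y - z)
  toUniformSpace := inferInstance
  uniformity_dist := rfl

theorem hasBasis_uniformity :
    (uniformity (EllP p I)).HasBasis (fun ε : ℝ => 0 < ε) (fun ε => {z | ‖z.1 - z.2‖ < ε}) := by
  have h : (uniformity (EllP p I)).HasBasis ((0 : ℝ) < ·)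
      (fun ε => {z | ‖z.1 - z.2‖ ^ p < ε}) :=
    let _ := pseudoMetricSpace p I
    Metric.uniformity_basis_dist
  refine h.to_hasBasis (fun ε hε => ?_) (fun ε hε => ?_)
  · exact ⟨ε ^ p⁻¹, Real.rpow_pos_of_pos hε _, fun z (hz : _ < _) =>
      (Real.lt_rpow_inv_iff_of_pos (norm_nonneg' _) hε.le hp.out).1 hz⟩
  · exact ⟨ε ^ p, Real.rpow_pos_of_pos hε p, fun z (hz : _ < _) =>
      (Real.rpow_lt_rpow_iff (norm_nonneg' _) hε.le hp.out).1 hz⟩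

theorem completeSpace : CompleteSpace (EllP p I) := by
  have hp0 := hp.out
  have : (uniformity (EllP p I)).IsCountablyGenerated :=
    let _ := pseudoMetricSpace p I
    inferInstance
  refine UniformSpace.complete_of_cauchySeq_tendsto fun u hu => ?_
  have hu' (ε : ℝ) (hε : 0 < ε) : ∃ N, ∀ m ≥ N, ∀ n ≥ N, ‖u m - u n‖ < ε :=
    (hasBasis_uniformity.cauchySeq_iff).1 hu ε hε
  have hc (i : I) : CauchySeq fun n => coord i (u n) := by
    rw [Metric.cauchySeq_iff]
    intro ε hε
    obtain ⟨N, hN⟩ := hu' ε hε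
    refine ⟨N, fun m hm n hn => ?_⟩
    rw [Real.dist_eq, ← map_sub]
    exact (abs_coord_le i _).trans_lt (hN m hm n hn)
  choose f hf using fun i => cauchySeq_tendsto_of_complete (hc i)
  -- Fatou's lemma for the counting measure
  have hfin {ε : ℝ} {N : ℕ} (hε : 0 < ε) (hN : ∀ m ≥ N, ∀ n ≥ N, ‖u m - u n‖ < ε) (m : ℕ)
      (hm : N ≤ m) (s : Finset I) : ∑ i ∈ s, |coord i (u m) - f i| ^ p ≤ ε ^ p := by
    have ht : Tendsto (fun n => ∑ i ∈ s, |coord i (u m) - coord i (u n)| ^ p) atTop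
        (𝓝 (∑ i ∈ s, |coord i (u m) - f i| ^ p)) :=
      tendsto_finsetSum _ fun i _ => ((hf i).const_sub _).abs.rpow_const (Or.inr hp0.le)
    refine le_of_tendsto ht ((eventually_ge_atTop N).mono fun n hn => ?_)
    calc ∑ i ∈ s, |coord i (u m) - coord i (u n)| ^ p
        = ∑ i ∈ s, |coord i (u m - u n)| ^ p := by simp only [map_sub]
      _ ≤ ∑' i, |coord i (u m - u n)| ^ p :=
        (summable_coord _).sum_le_tsum s fun i _ => by positivity
      _ = ‖u m - u n‖ ^ p := (rpow_norm _).symm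
      _ ≤ ε ^ p := Real.rpow_le_rpow (norm_nonneg' _) (hN m hm n hn).le hp0.le
  obtain ⟨N₁, hN₁⟩ := hu' 1 one_pos
  obtain ⟨y, hy⟩ := exists_coord_eq (f := fun i => coord i (u N₁) - f i)
    (summable_of_sum_le (fun i => by positivity) (hfin one_pos hN₁ N₁ le_rfl))
  refine ⟨u N₁ - y, (nhds_basis_uniformity hasBasis_uniformity).tendsto_right_iff.2
    fun ε hε => ?_⟩
  obtain ⟨N, hN⟩ := hu' (ε / 2) (half_pos hε)
  refine (eventually_ge_atTop N).mono fun n hn => ?_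
  have h1 : ‖u n - (u N₁ - y)‖ ^ p ≤ (ε / 2) ^ p := by
    rw [rpow_norm]
    refine (summable_coord _).tsum_le_of_sum_le fun s => ?_
    simpa [hy] using hfin (half_pos hε) hN n hn s
  have h2 := (Real.rpow_le_rpow_iff (norm_nonneg' _) (half_pos hε).le hp0).1 h1
  exact h2.trans_lt (half_lt_self hε)

instance : PBanachSpace p (EllP p I) where
  norm_nonneg := norm_nonneg'
  eq_zero_of_norm_eq_zero x h := ext_coord fun i => by
    have := abs_coord_le i x
    rw [h] at this
    rw [map_zero]
    exact abs_nonpos_iff.1 this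
  norm_smul c x := by
    refine (Real.rpow_left_inj (norm_nonneg' _) (mul_nonneg (abs_nonneg c) (norm_nonneg' x))
      hp.out.ne').1 ?_
    rw [Real.mul_rpow (abs_nonneg c) (norm_nonneg' x), rpow_norm, rpow_norm, ← tsum_mul_left]
    refine tsum_congr fun i => ?_
    rw [map_smul, smul_eq_mul, abs_mul, Real.mul_rpow (abs_nonneg _) (abs_nonneg _)]
  norm_add_rpow_le := norm_add_rpow_le hp.out hp1.out
  hasBasis_uniformity := hasBasis_uniformity
  complete := completeSpace

instance : IsUniformAddGroup (EllP p I) := PBanachSpace.isUniformAddGroup p _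

instance : T2Space (EllP p I) := PBanachSpace.t2Space p _

instance : ContinuousSMul ℝ (EllP p I) := PBanachSpace.continuousSMul p _

instance : (uniformity (EllP p I)).IsCountablyGenerated :=
  PBanachSpace.isCountablyGenerated_uniformity p _

theorem continuous_coord (i : I) : Continuous (coord i : EllP p I → ℝ) := by
  refine continuous_of_continuousAt_zero (coord i : EllP p I →ₗ[ℝ] ℝ) ?_
  have h : Tendsto (fun x : EllP p I => ‖x - 0‖ ^ p) (𝓝 0) (𝓝 0) :=
    (PBanachSpace.tendsto_iff_rpow p).1 tendsto_id
  have h' := h.rpow_const (p := p⁻¹) (Or.inr (inv_nonneg.2 hp.out.le))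
  rw [Real.zero_rpow (inv_ne_zero hp.out.ne')] at h'
  rw [ContinuousAt, map_zero, tendsto_zero_iff_abs_tendsto_zero]
  refine squeeze_zero (fun _ => abs_nonneg _) (fun x => ?_) h'
  rw [Real.rpow_rpow_inv (norm_nonneg' _) hp.out.ne', sub_zero]
  exact abs_coord_le i x

theorem hasSum_single (x : EllP p I) : HasSum (fun i => coord i x • single p i) x := by
  have hs : Summable fun i => coord i x • single p i := by
    refine PBanachSpace.summable_of_rpow p ?_
    simpa only [PBanachSpace.norm_smul p, norm_single, mul_one] using summable_coord x
  convert hs.hasSum using 1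
  refine ext_coord fun j => ?_
  have h := hs.hasSum.map (coord j : EllP p I →ₗ[ℝ] ℝ) (continuous_coord j)
  have h' := _root_.hasSum_single j (f := coord j ∘ fun i => coord i x • single p i)
    fun i hi => by simp [coord_single, hi.symm]
  simpa [coord_single] using h'.unique h

theorem isClosed_supported (s : Set I) : IsClosed (supported p s : Set (EllP p I)) := by
  have : (supported p s : Set (EllP p I)) = ⋂ i ∈ sᶜ, {x | coord i x = 0} := by
    ext x
    simp [supported]
  rw [this]
  exact isClosed_biInter fun i _ => isClosed_eq (continuous_coord i) continuous_const

theorem supported_le_of_isClosed {s : Set I} {K : Submodule ℝ (EllP p I)}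
    (hK : IsClosed (K : Set (EllP p I))) (h : ∀ i ∈ s, single p i ∈ K) : supported p s ≤ K := by
  intro x hx
  refine hK.mem_of_tendsto (hasSum_single x) (Eventually.of_forall fun t => ?_)
  refine K.sum_mem fun i _ => ?_
  by_cases hi : i ∈ s
  · exact K.smul_mem _ (h i hi)
  · rw [hx i hi, zero_smul]
    exact K.zero_mem

theorem mem_of_single_mem {K : Submodule ℝ (EllP p I)}
    (hK : IsClosed (K : Set (EllP p I))) (h : ∀ i, single p i ∈ K) (x : EllP p I) : x ∈ K :=
  supported_le_of_isClosed (s := Set.univ) hK (fun i _ => h i) fun _ hi => (hi trivial).elim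

theorem isSeparable_supported {s : Set I} (hs : s.Countable) :
    IsSeparable (supported p s : Set (EllP p I)) := by
  have h : IsSeparable (Submodule.span ℝ (single p '' s) : Set (EllP p I)) :=
    (hs.image _).isSeparable.span
  refine h.closure.mono (supported_le_of_isClosed
    (K := (Submodule.span ℝ (single p '' s)).topologicalClosure)
    (Submodule.isClosed_topologicalClosure _) fun i hi => ?_)
  exact Submodule.le_topologicalClosure _ (Submodule.subset_span ⟨i, hi, rfl⟩)

theorem exists_countable_supported {Y : Set (EllP p I)} (hY : IsSeparable Y) :
    ∃ s : Set I, s.Countable ∧ Y ⊆ supported p s := by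
  obtain ⟨c, hc, hYc⟩ := hY
  refine ⟨⋃ x ∈ c, {i | coord i x ≠ 0}, hc.biUnion fun x _ => ?_, hYc.trans ?_⟩
  · refine (summable_coord x).countable_support.mono fun i (hi : coord i x ≠ 0) => ?_
    exact (Real.rpow_pos_of_pos (abs_pos.2 hi) p).ne'
  · refine closure_minimal (fun x hx i hi => ?_) (isClosed_supported _)
    by_contra h
    exact hi (Set.mem_biUnion hx h)

section Lift

variable {E : Type*} [AddCommGroup E] [Module ℝ E] [Norm E] [UniformSpace E] [PBanachSpace p E]

theorem continuousLinearMap_ext {F : Type*} [AddCommGroup F] [Module ℝ F] [TopologicalSpace F]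
    [T2Space F] {A B : EllP p I →L[ℝ] F} (h : ∀ i, A (single p i) = B (single p i)) : A = B :=
  ContinuousLinearMap.ext <| mem_of_single_mem
    (K := LinearMap.eqLocus (A : EllP p I →ₗ[ℝ] F) B) (isClosed_eq A.continuous B.continuous) h

/-- The universal property of `ℓ_p(I)`: every bounded family in a `p`-Banach space is the image
of the unit vectors under an operator. -/
theorem exists_lift (v : I → E) (C : ℝ) (hv : ∀ i, ‖v i‖ ≤ C) :
    ∃ A : EllP p I →L[ℝ] E, ∀ i, A (single p i) = v i := by
  have := PBanachSpace.isUniformAddGroup p E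
  have := PBanachSpace.continuousSMul p E
  have := PBanachSpace.t2Space p E
  have hle (x : EllP p I) (i : I) : ‖coord i x • v i‖ ^ p ≤ |C| ^ p * |coord i x| ^ p := by
    rw [PBanachSpace.norm_smul p,
      Real.mul_rpow (abs_nonneg _) (PBanachSpace.norm_nonneg p _), mul_comm]
    exact mul_le_mul_of_nonneg_right (Real.rpow_le_rpow (PBanachSpace.norm_nonneg p _)
      ((hv i).trans (le_abs_self C)) hp.out.le) (by positivity)
  have hsp (x : EllP p I) : Summable fun i => ‖coord i x • v i‖ ^ p :=
    ((summable_coord x).mul_left _).of_nonneg_of_le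
      (fun i => Real.rpow_nonneg (PBanachSpace.norm_nonneg p _) p) (hle x)
  have hs (x : EllP p I) : Summable fun i => coord i x • v i :=
    PBanachSpace.summable_of_rpow p (hsp x)
  let A : EllP p I →ₗ[ℝ] E :=
    { toFun := fun x => ∑' i, coord i x • v i
      map_add' := fun x y => by
        rw [← (hs x).tsum_add (hs y)]
        simp only [map_add, add_smul]
      map_smul' := fun c x => by
        rw [RingHom.id_apply, ← (hs x).tsum_const_smul c]
        simp only [map_smul, smul_assoc] }
  refine ⟨⟨A, PBanachSpace.continuous_of_rpow_le p A (|C| ^ p) fun x => ?_⟩, fun i => ?_⟩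
  · rw [rpow_norm, ← tsum_mul_left]
    exact (PBanachSpace.rpow_norm_tsum_le p (hsp x)).trans
      ((hsp x).tsum_le_tsum (hle x) ((summable_coord x).mul_left _))
  · change ∑' j, coord j (single p i) • v j = v i
    rw [tsum_eq_single i]
    · simp [coord_single]
    · intro j hj
      simp [coord_single, hj]

end Lift

end EllP

/-! ### Separable complementation in kernels -/

/-- If the operator `A` maps the unit vectors of `ℓ_p(J)` onto a set containing the unit ball of a
space with the separable complementation property, then `ker A` has that property. For a suitable
countable `s ⊆ J` the operator `A` maps the vectors supported on `s` onto a complemented subspace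
`W`; lifting the projection onto `W` through `A` gives a projection of `ℓ_p(J)` onto the vectors
supported on `s` that preserves `ker A`. -/
theorem HasSCP.ker {p : ℝ} [hp : Fact (0 < p)] [hp1 : Fact (p ≤ 1)] {X : Type u} [AddCommGroup X]
    [Module ℝ X] [Norm X] [UniformSpace X] [PBanachSpace p X] (hX : HasSCP X) {J : Type v}
    (A : EllP p J →L[ℝ] X) (hA : ∀ x : X, ‖x‖ ≤ 1 → ∃ j, A (EllP.single p j) = x) :
    HasSCP (LinearMap.ker A.toLinearMap) := by
  have := PBanachSpace.isUniformAddGroup p X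
  have := PBanachSpace.continuousSMul p X
  have := PBanachSpace.t2Space p X
  have := PBanachSpace.isCountablyGenerated_uniformity p X
  intro Y hY
  obtain ⟨s₀, hs₀, hYs₀⟩ := EllP.exists_countable_supported (hY.image continuous_subtype_val)
  obtain ⟨W, hW, hWsep, P, hP⟩ := hX (Submodule.span ℝ ((fun j => A (EllP.single p j)) '' s₀))
    (hs₀.image _).isSeparable.span
  obtain ⟨D, hDW, hD, hWD⟩ :=
    (hWsep.mono (Set.inter_subset_left (t := {x | ‖x‖ ≤ 1}))).exists_countable_dense_subset
  have : Nonempty J :=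
    ⟨(hA 0 ((PBanachSpace.norm_zero p X).trans_le zero_le_one)).choose⟩
  choose! σ hσ using hA
  let s : Set J := s₀ ∪ σ '' D
  have hs : s.Countable := hs₀.union (hD.image σ)
  have hsW : ∀ j ∈ s, A (EllP.single p j) ∈ W := by
    rintro j (hj | ⟨d, hd, rfl⟩)
    · exact hW (Submodule.subset_span ⟨j, hj, rfl⟩)
    · rw [hσ d (hDW hd).2]
      exact (hDW hd).1
  -- bounded lifts of `W` to vectors supported on `s`
  obtain ⟨C, hC⟩ : ∃ C : ℝ, ∀ y ∈ W, ∃ x ∈ EllP.supported p s, A x = y ∧ ‖x‖ ≤ C * ‖y‖ := by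
    let _ : Norm (EllP.supported p s) := ⟨fun x => ‖(x : EllP p J)‖⟩
    have : PBanachSpace p (EllP.supported p s) :=
      PBanachSpace.submodule p (EllP.isClosed_supported s)
    obtain ⟨C, hC⟩ := PBanachSpace.exists_preimage_of_approx p
      (A.comp (EllP.supported p s).subtypeL) W 1 (by
        intro y hy
        rcases (PBanachSpace.norm_nonneg p y).eq_or_lt with h0 | h0
        · refine ⟨0, ?_, ?_, ?_⟩
          · rw [map_zero]; exact W.zero_mem
          · rw [PBanachSpace.norm_zero p, ← h0, mul_zero]
          · rw [map_zero, sub_zero, ← h0, mul_zero]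
        have hy1 : ‖y‖⁻¹ • y ∈ (W : Set X) ∩ {x | ‖x‖ ≤ 1} := by
          refine ⟨W.smul_mem _ hy, ?_⟩
          change ‖‖y‖⁻¹ • y‖ ≤ 1
          rw [PBanachSpace.norm_smul p, abs_of_pos (inv_pos.2 h0), inv_mul_cancel₀ h0.ne']
        obtain ⟨d, hd1, hd⟩ := mem_closure_iff_nhds.1 (hWD hy1) _
          ((PBanachSpace.nhds_hasBasis p _).mem_of_mem (one_half_pos (α := ℝ)))
        have hdA : A (EllP.single p (σ d)) = d := hσ d (hDW hd).2
        refine ⟨‖y‖ • ⟨EllP.single p (σ d),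
          EllP.single_mem_supported (Or.inr ⟨d, hd, rfl⟩)⟩, ?_, ?_, ?_⟩
        · change A (‖y‖ • EllP.single p (σ d)) ∈ W
          rw [map_smul, hdA]
          exact W.smul_mem _ (hDW hd).1
        · change ‖‖y‖ • EllP.single p (σ d)‖ ≤ _
          rw [PBanachSpace.norm_smul p, EllP.norm_single, abs_of_pos h0, mul_one, one_mul]
        · change ‖y - A (‖y‖ • EllP.single p (σ d))‖ ≤ _
          have e : y - A (‖y‖ • EllP.single p (σ d)) = (-‖y‖) • (d - ‖y‖⁻¹ • y) := by
            rw [map_smul, hdA, smul_sub, smul_smul, neg_mul, mul_inv_cancel₀ h0.ne', neg_smul,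
              neg_smul, one_smul]
            abel
          rw [e, PBanachSpace.norm_smul p, abs_neg, abs_of_pos h0, mul_comm]
          exact mul_le_mul_of_nonneg_right (le_of_lt hd1) h0.le)
    refine ⟨C, fun y hy => ?_⟩
    obtain ⟨x, hx, hx'⟩ := hC y hy
    exact ⟨x, x.2, hx, hx'⟩
  let PA : EllP p J →L[ℝ] X := (W.subtypeL.comp P).comp A
  have hPA : ∀ x, A x ∈ W → PA x = A x := fun x hx => congrArg Subtype.val (hP ⟨A x, hx⟩)
  obtain ⟨B, -, hB⟩ := PBanachSpace.exists_norm_le p PA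
  have hv : ∀ j, ∃ x ∈ EllP.supported p s, A x = PA (EllP.single p j) ∧ ‖x‖ ≤ max 1 (|C| * B) ∧
      (j ∈ s → x = EllP.single p j) := by
    intro j
    by_cases hj : j ∈ s
    · exact ⟨EllP.single p j, EllP.single_mem_supported hj, (hPA _ (hsW j hj)).symm,
        EllP.norm_single (p := p) j ▸ le_max_left _ _, fun _ => rfl⟩
    · obtain ⟨x, hxs, hx, hxC⟩ := hC (PA (EllP.single p j)) (P (A (EllP.single p j))).2
      refine ⟨x, hxs, hx, le_max_of_le_right (hxC.trans ?_), fun h => (hj h).elim⟩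
      have := hB (EllP.single p j)
      rw [EllP.norm_single, mul_one] at this
      exact mul_le_mul (le_abs_self C) this (PBanachSpace.norm_nonneg p _) (abs_nonneg C)
  choose v hvs hvA hvB hv1 using hv
  obtain ⟨R, hR⟩ := EllP.exists_lift (p := p) v _ hvB
  have hAR : A.comp R = PA := EllP.continuousLinearMap_ext fun j => by
    rw [ContinuousLinearMap.comp_apply, hR, hvA]
  have hRs : ∀ x, R x ∈ EllP.supported p s := EllP.mem_of_single_mem
    (K := (EllP.supported p s).comap R.toLinearMap)
    ((EllP.isClosed_supported s).preimage R.continuous) fun j => by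
      rw [Submodule.mem_comap]
      exact (hR j).symm ▸ hvs j
  have hR1 : EllP.supported p s ≤ LinearMap.eqLocus R.toLinearMap LinearMap.id :=
    EllP.supported_le_of_isClosed (isClosed_eq R.continuous continuous_id)
      fun j hj => (hR j).trans (hv1 j hj)
  have hRker : ∀ x : LinearMap.ker A.toLinearMap, R x ∈ LinearMap.ker A.toLinearMap := by
    rintro ⟨x, hx⟩
    have hx' : A x = 0 := hx
    change A (R x) = 0
    rw [← ContinuousLinearMap.comp_apply, hAR, hPA x (hx' ▸ W.zero_mem), hx']
  refine ⟨(EllP.supported p s).comap (LinearMap.ker A.toLinearMap).subtype, fun y hy => ?_, ?_,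
    ((R.comp (LinearMap.ker A.toLinearMap).subtypeL).codRestrict _ hRker).codRestrict _
      fun x => hRs x, ?_⟩
  · exact EllP.supported_mono Set.subset_union_left (hYs₀ ⟨y, hy, rfl⟩)
  · exact IsInducing.subtypeVal.isSeparable_preimage (EllP.isSeparable_supported hs)
  · rintro ⟨⟨x, hx⟩, hxs⟩
    exact Subtype.ext (Subtype.ext (hR1 hxs))

theorem theorem5p1 (p : ℝ) [Fact (0 < p)] [Fact (p ≤ 1)]
    (X : Type u) [AddCommGroup X] [Module ℝ X] [Norm X] [UniformSpace X] [PBanachSpace p X]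
    (hSCP : HasSCP X) (hdens : densityCharacter X = Cardinal.aleph 1)
    (I : Type v) (Q : EllP p I →L[ℝ] X) (hQ : Function.Surjective Q) :
    ∃ (Z : Type (max u v)) (_ : AddCommGroup Z) (_ : Module ℝ Z) (_ : Norm Z)
      (_ : UniformSpace Z),
      PBanachSpace p Z ∧ HasSCP Z ∧
        ∃ W : Submodule ℝ Z, W.ClosedComplemented ∧
          Nonempty (LinearMap.ker Q.toLinearMap ≃L[ℝ] W) := by
  have := PBanachSpace.isUniformAddGroup p X
  have := PBanachSpace.t2Space p X
  obtain ⟨B, -, hB⟩ := PBanachSpace.exists_norm_le p Q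
  obtain ⟨C, hC⟩ := PBanachSpace.exists_preimage_norm_le p Q hQ
  choose l hlQ hlC using hC
  let J := {x : X // ‖x‖ ≤ 1} ⊕ I
  obtain ⟨A, hA⟩ := EllP.exists_lift (p := p) (I := J)
    (Sum.elim Subtype.val fun i => Q (EllP.single p i)) (max 1 B) (by
      rintro (x | i)
      · exact x.2.trans (le_max_left _ _)
      · have := hB (EllP.single p i)
        rw [EllP.norm_single, mul_one] at this
        exact this.trans (le_max_right _ _))
  -- extension by zero
  obtain ⟨ι, hι⟩ := EllP.exists_lift (p := p) (fun i : I => EllP.single p (Sum.inr i : J)) 1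
    fun i => (EllP.norm_single _).le
  -- a lift of `A` through `Q`, left inverse to `ι`
  obtain ⟨ρ, hρ⟩ := EllP.exists_lift (p := p) (I := J)
    (Sum.elim (fun x => l x.1) fun i => EllP.single p i) (max |C| 1) (by
      rintro (x | i)
      · refine (hlC x.1).trans (le_max_of_le_left ?_)
        exact (mul_le_mul_of_nonneg_right (le_abs_self C) (PBanachSpace.norm_nonneg p _)).trans
          (mul_le_of_le_one_right (abs_nonneg C) x.2)
      · exact (EllP.norm_single i).le.trans (le_max_right _ _))
  have hAι : A.comp ι = Q := EllP.continuousLinearMap_ext fun i => by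
    rw [ContinuousLinearMap.comp_apply, hι, hA, Sum.elim_inr]
  have hQρ : Q.comp ρ = A := EllP.continuousLinearMap_ext fun j => by
    rw [ContinuousLinearMap.comp_apply, hρ, hA]
    rcases j with x | i
    · exact hlQ x.1
    · rfl
  have hρι : ρ.comp ι = ContinuousLinearMap.id ℝ _ := EllP.continuousLinearMap_ext fun i => by
    rw [ContinuousLinearMap.comp_apply, hι, hρ]
    rfl
  let f : LinearMap.ker Q.toLinearMap →L[ℝ] LinearMap.ker A.toLinearMap :=
    (ι.comp (LinearMap.ker Q.toLinearMap).subtypeL).codRestrict _ fun x =>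
      (DFunLike.congr_fun hAι (x : EllP p I)).trans x.2
  let g : LinearMap.ker A.toLinearMap →L[ℝ] LinearMap.ker Q.toLinearMap :=
    (ρ.comp (LinearMap.ker A.toLinearMap).subtypeL).codRestrict _ fun x =>
      (DFunLike.congr_fun hQρ (x : EllP p J)).trans x.2
  have hgf : Function.LeftInverse g f := fun x => Subtype.ext (DFunLike.congr_fun hρι (x : EllP p I))
  refine ⟨LinearMap.ker A.toLinearMap, inferInstance, inferInstance, ⟨fun x => ‖(x : EllP p J)‖⟩,
    inferInstance, PBanachSpace.submodule p (isClosed_singleton.preimage A.continuous),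
    hSCP.ker A fun x hx => ⟨Sum.inl ⟨x, hx⟩, hA _⟩, f.range,
    f.closedComplemented_range_of_leftInverse g hgf, ⟨?_⟩⟩
  refine ContinuousLinearEquiv.equivOfInverse (f.codRestrict f.range fun x => ⟨x, rfl⟩)
    (g.comp f.range.subtypeL) hgf ?_
  rintro ⟨_, x, rfl⟩
  exact Subtype.ext (congrArg f (hgf x))
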